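/- **Setting.** Let $S$ be a closed connected oriented surface of genus $g$ and $Z\subset S$ a finite non-empty set. A *veering triangulation* $\tau$ of $(S,Z)$ is a triangulation with vertex set $Z$, every edge coloured red or blue, without monochromatic triangles or monochromatic vertices; its edges are labelled by an alphabet $\mathcal A$ of size $d=6g-6+3|Z|$. In each triangle, going anti-clockwise, the *widest* edge is the one followed by a blue and preceded by a red edge, and the *tallest* edge is the one followed by a red and preceded by a blue edge. An edge is *forward* (*backward*) *flippable* if it is the widest (tallest) edge of both adjacent triangles. The *width polytope* $\mathcal H_\tau\subset\mathbb R^{\mathcal A}_{\ge0}$ is given by the equations: in each triangle the width of the widest edge is the sum of the widths of the other two. The *height polytope* is defined in the same way with tallest edges. $\tau$ is *core* if both have dimension $D$, the complex dimension of the stratum component of quadratic differentials determined by $\tau$ ($2g-2+|Z|$, plus one if the component consists of squares of abelian differentials). For positive widths and heights $(x,y)$, $\tau$ is *balanced for* $(x,y)$ if $x_e\le1$ for each forward flippable $e$ and each backward flippable edge has width $>1$ after being flipped back. $B_\tau$ is the set of $(x,y)$ of area one for which $\tau$ is balanced; $\tau$ is *balanced* if it is core and the set of surfaces given by $B_\tau$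 has non-empty interior in the unit-area stratum component. Put $|x|=\sum_{a\in\mathcal A} x_a$, $\rho(x)=x/|x|$ and $\Delta=\{x\in\mathbb R^{\mathcal A}_{\ge0}: |x|=1\}$, and let $H_\tau\subset\Delta$ be the set of $\rho(x)$ for $(x,y)\in B_\tau$ with $x_e=1$ for some forward flippable $e$. Let $e$ be forward flippable in $\tau$, with sides $a,b,c,d$ of its quadrilateral in anti-clockwise order, $a,c$ blue and $b,d$ red. Flipping $e$ replaces it by the other diagonal, with the same label, coloured red or blue; the flip matrix is $I+E_{ea}+E_{ec}$ if the new edge is red and $I+E_{eb}+E_{ed}$ if it is blue, and old widths are the flip matrix applied to new widths. A *finite flip sequence* $\gamma$ from $\sigma$ to $\tau$ is a finite (possibly empty) sequence of labelled balanced triangulations from $\sigma$ to $\tau$, each obtained from the preceding one by flipping, simultaneously, a non-empty set of forward flippable edges. $A_\gamma$ is the product, in order, of the flip matrices, $v_{\gamma,s}$ is the column of $A_\gamma$ with label $s$, and $H_\gamma=\{\rho(A_\gamma x'):x'\in H_\tau\}$. Let $\ell$ be $(D-1)$-dimensional Lebesgue measure on $\mathcal H_\sigma\cap\Delta$. The *flip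 sequence of widths* $x'\in H_\tau$ is obtained by repeatedly flipping all edges of maximal width, the colours of the flipped edges being those for which the new widths are positive (if there is no such choice, the sequence ends). For $r\in\mathcal A$ and $M>1$ let $X_{M,r}$ be the set of $x=\rho(A_\gamma x')\in H_\gamma$, $x'\in H_\tau$, such that $$|v_{\gamma\zeta,r}|>M\max_{s\in\mathcal A}|v_{\gamma,s}|$$ for some finite initial segment $\zeta$ of the flip sequence of $x'$ in which the label $r$ is not flipped. **Proposition.** There are constants $c>0$ and $M_0>1$, depending only on the stratum component (in fact only on the number $6g-6+3|Z|$ of edges), such that for all $M>M_0$, every finite flip sequence $\gamma$ of labelled balanced triangulations, and every label $r\in\mathcal A$, $$\ell(X_{M,r})<\frac{c}{M}\,\ell(H_\gamma).$$ -/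

import Mathlib

open MeasureTheory Topology
open scoped ENNReal Matrix

/-- A labelled veering triangulation of a closed connected oriented surface `S` with finite vertex
set `Z`, whose edges are labelled by `A`.  The two sides of the edge labelled `a` are the darts
`(a, true)` and `(a, false)`; a dart is the edge oriented so that the adjacent triangle lies on its
left, and `next` sends a dart to the following one, anti-clockwise around that triangle.  The
surface is obtained by gluing the triangles along opposite darts, so it is closed and oriented.
`isRed a` says that the edge is red (positive slope), otherwise it is blue (negative slope). -/
structure VeeringTriangulation (A : Type*) where
  next : Equiv.Perm (A × Bool)
  isRed : A → Bool
  /-- the orbits of `next` are triangles -/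
  next_next_next : ∀ d, next (next (next d)) = d
  next_ne : ∀ d, next d ≠ d
  /-- the surface is connected -/
  connected : ∀ d d' : A × Bool,
    Relation.ReflTransGen (fun u v : A × Bool => v = next u ∨ v = (u.1, !u.2)) d d'
  /-- no triangle is monochromatic -/
  triangle_colours : ∀ d,
    ¬ (isRed d.1 = isRed (next d).1 ∧ isRed d.1 = isRed (next (next d)).1)
  /-- no vertex is monochromatic: turning anti-clockwise about the initial vertex of a dart `d`
  sends `d` to the opposite of the dart that precedes it in its triangle -/
  vertex_colours : ∀ d, ∃ k : ℕ,
    isRed (((fun u : A × Bool => ((next.symm u).1, !(next.symm u).2))^[k] d).1) ≠ isRed d.1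

namespace VeeringTriangulation

variable {A : Type*}

/-- The opposite dart: the same edge with the other orientation. -/
def opp : Equiv.Perm (A × Bool) where
  toFun d := (d.1, !d.2)
  invFun d := (d.1, !d.2)
  left_inv d := by simp
  right_inv d := by simp

/-- The permutation of the darts that turns anti-clockwise about their initial vertices. -/
def turn (τ : VeeringTriangulation A) : Equiv.Perm (A × Bool) := τ.next.symm.trans opp

/-- The number `|Z|` of vertices: the number of orbits of `turn`. -/
noncomputable def numVertices (τ : VeeringTriangulation A) : ℕ :=
  Nat.card (Quotient (Equiv.Perm.SameCycle.setoid τ.turn))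

/-- The number of triangles: the number of orbits of `next`. -/
noncomputable def numTriangles (τ : VeeringTriangulation A) : ℕ :=
  Nat.card (Quotient (Equiv.Perm.SameCycle.setoid τ.next))

/-- The Euler characteristic `2 - 2g` of the surface. -/
noncomputable def eulerChar (τ : VeeringTriangulation A) : ℤ :=
  (τ.numVertices : ℤ) - (Nat.card A : ℤ) + (τ.numTriangles : ℤ)

/-- The edge of the dart `d` is the widest edge of the triangle to the left of `d`: its successor
is blue and its predecessor is red. -/
abbrev Wide (τ : VeeringTriangulation A) (d : A × Bool) : Prop :=
  τ.isRed (τ.next d).1 = false ∧ τ.isRed (τ.next (τ.next d)).1 = true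

/-- The edge of the dart `d` is the tallest edge of the triangle to the left of `d`: its successor
is red and its predecessor is blue. -/
abbrev Tall (τ : VeeringTriangulation A) (d : A × Bool) : Prop :=
  τ.isRed (τ.next d).1 = true ∧ τ.isRed (τ.next (τ.next d)).1 = false

/-- The edge `e` is forward flippable: with `a, b, c, d` the sides of its quadrilateral in
anti-clockwise order, `a, c` are blue and `b, d` are red. -/
def ForwardFlippable (τ : VeeringTriangulation A) (e : A) : Prop := ∀ s, τ.Wide (e, s)

/-- The edge `e` is backward flippable: with `a, b, c, d` the sides of its quadrilateral in
anti-clockwise order, `a, c` are red and `b, d` are blue. -/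
def BackwardFlippable (τ : VeeringTriangulation A) (e : A) : Prop := ∀ s, τ.Tall (e, s)

/-- The width polytope (a polyhedral cone): non-negative widths such that in every triangle the
width of the widest edge is the sum of the other two. -/
def widthCone (τ : VeeringTriangulation A) : Set (A → ℝ) :=
  {x | (∀ a, 0 ≤ x a) ∧
    ∀ d, τ.Wide d → x d.1 = x (τ.next d).1 + x (τ.next (τ.next d)).1}

/-- The height polytope (a polyhedral cone): non-negative heights such that in every triangle the
height of the tallest edge is the sum of the other two. -/
def heightCone (τ : VeeringTriangulation A) : Set (A → ℝ) :=
  {y | (∀ a, 0 ≤ y a) ∧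
    ∀ d, τ.Tall d → y d.1 = y (τ.next d).1 + y (τ.next (τ.next d)).1}

/-- The quadratic differentials carried by the triangulation are squares of abelian differentials.
The function `s` records whether a dart points to the right (`true`) or to the left: opposite darts
point in opposite directions, and in each triangle the widest edge points against the other two. -/
def IsAbelian (τ : VeeringTriangulation A) : Prop :=
  ∃ s : A × Bool → Bool, (∀ d, s (opp d) = !(s d)) ∧
    ∀ d, τ.Wide d → s (τ.next d) = !(s d) ∧ s (τ.next (τ.next d)) = !(s d)

open Classical in
/-- The complex dimension `D` of the stratum component of the triangulation: `2g - 2 + |Z|`, and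
one more when the component consists of squares of abelian differentials. -/
noncomputable def stratumDim (τ : VeeringTriangulation A) : ℤ :=
  (τ.numVertices : ℤ) - τ.eulerChar + if τ.IsAbelian then 1 else 0

/-- Core triangulations: both the width and the height polytope have the expected dimension. -/
def IsCore (τ : VeeringTriangulation A) : Prop :=
  (Module.finrank ℝ (Submodule.span ℝ τ.widthCone) : ℤ) = τ.stratumDim ∧
  (Module.finrank ℝ (Submodule.span ℝ τ.heightCone) : ℤ) = τ.stratumDim

/-- The area form `Ω(x, y)`.  Each triangle is counted once, through its widest edge `e = d`; with
`b` its tallest and `a` its remaining edge, it contributes `(x_e y_a + x_a y_b - x_a y_a) / 2`. -/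
noncomputable def area [Fintype A] (τ : VeeringTriangulation A) (x y : A → ℝ) : ℝ :=
  ∑ d : A × Bool, if τ.Wide d then
    (let e := d.1
     let a := if τ.isRed d.1 then (τ.next d).1 else (τ.next (τ.next d)).1
     let b := if τ.isRed d.1 then (τ.next (τ.next d)).1 else (τ.next d).1
     (x e * y a + x a * y b - x a * y a) / 2)
  else 0

/-- The parameters of the unit-area half-translation surfaces for which `τ` is a straight veering
triangulation: no edge is vertical or horizontal, so widths and heights are positive. -/
def unitAreaCone [Fintype A] (τ : VeeringTriangulation A) : Set ((A → ℝ) × (A → ℝ)) :=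
  {p | p.1 ∈ τ.widthCone ∧ p.2 ∈ τ.heightCone ∧ (∀ a, 0 < p.1 a) ∧ (∀ a, 0 < p.2 a) ∧
    τ.area p.1 p.2 = 1}

/-- The width of a backward flippable edge `f` after it has been flipped back: the widths of the
two sides of its quadrilateral whose colour is opposite to that of `f` are added to that of `f`. -/
noncomputable def backWidth (τ : VeeringTriangulation A) (x : A → ℝ) (f : A) : ℝ :=
  x f + ∑ s : Bool, x (if τ.isRed f then τ.next (τ.next (f, s)) else τ.next (f, s)).1

/-- The triangulation is (horizontally) balanced for the widths `x`. -/
def BalancedFor (τ : VeeringTriangulation A) (x : A → ℝ) : Prop :=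
  (∀ e, τ.ForwardFlippable e → x e ≤ 1) ∧ (∀ f, τ.BackwardFlippable f → 1 < τ.backWidth x f)

/-- The set `B_τ` of unit-area parameters for which `τ` is balanced. -/
def balancedParams [Fintype A] (τ : VeeringTriangulation A) : Set ((A → ℝ) × (A → ℝ)) :=
  {p | p ∈ τ.unitAreaCone ∧ τ.BalancedFor p.1}

/-- Balanced triangulations: core triangulations for which the surfaces with parameters in `B_τ`
have non-empty interior in the unit-area stratum component, whose topology is that of the
widths and heights (the periods). -/
def IsBalanced [Fintype A] (τ : VeeringTriangulation A) : Prop :=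
  τ.IsCore ∧ ∃ p ∈ τ.balancedParams, τ.balancedParams ∈ 𝓝[τ.unitAreaCone] p

/-- The upper boundary of `B_τ`: some forward flippable edge has width one. -/
def upperBoundary [Fintype A] (τ : VeeringTriangulation A) : Set ((A → ℝ) × (A → ℝ)) :=
  {p | p ∈ τ.balancedParams ∧ ∃ e, τ.ForwardFlippable e ∧ p.1 e = 1}

end VeeringTriangulation

/-- The projection `ρ(x) = x / |x|`, `|x| = ∑ x_a`, to the standard simplex. -/
noncomputable def simplexProj {A : Type*} [Fintype A] (x : A → ℝ) : A → ℝ := (∑ a, x a)⁻¹ • x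

/-- The set `H_τ = ρ(π_h(∂⁺B_τ))` of normalised widths in the upper boundary. -/
noncomputable def VeeringTriangulation.normWidths {A : Type*} [Fintype A]
    (τ : VeeringTriangulation A) : Set (A → ℝ) :=
  (fun p : (A → ℝ) × (A → ℝ) => simplexProj p.1) '' τ.upperBoundary

/-- `τ'` is obtained from `τ` by flipping forward, simultaneously, the edges with labels in the
non-empty set `F`, with the induced labelling.  (Quadrilaterals of distinct forward flippable edges
have no triangle in common.)  For an oriented flipped edge `d`, the triangles `(d, a, b)` and
`(opp d, c, d')` are replaced by `(d, b, c)` and `(opp d, d', a)`; a flipped edge may become red or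
blue. -/
structure FlipsTo {A : Type*} (τ : VeeringTriangulation A) (F : Finset A)
    (τ' : VeeringTriangulation A) : Prop where
  nonempty : F.Nonempty
  flippable : ∀ e ∈ F, τ.ForwardFlippable e
  colour : ∀ a, a ∉ F → τ'.isRed a = τ.isRed a
  next_diag : ∀ e ∈ F, ∀ s, τ'.next (e, s) = τ.next (τ.next (e, s))
  next_side : ∀ e ∈ F, ∀ s, τ'.next (τ.next (τ.next (e, s))) = τ.next (e, !s)
  next_side' : ∀ e ∈ F, ∀ s, τ'.next (τ.next (e, !s)) = (e, s)
  next_other : ∀ d : A × Bool, d.1 ∉ F → (τ.next d).1 ∉ F → (τ.next (τ.next d)).1 ∉ F →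
    τ'.next d = τ.next d

/-- The matrix of a flip: `I + E_{ea} + E_{ec}` if `e` becomes red and `I + E_{eb} + E_{ed}` if it
becomes blue, where `a, b, c, d` are the sides of the quadrilateral of `e`.  For a simultaneous flip
it is the product of these (commuting) matrices, which is the identity plus the sum of the
elementary terms.  Old widths are the matrix applied to the new widths. -/
noncomputable def flipMatrix {A : Type*} [Fintype A] [DecidableEq A]
    (τ : VeeringTriangulation A) (F : Finset A) (τ' : VeeringTriangulation A) : Matrix A A ℝ :=
  1 + ∑ e ∈ F, ∑ s : Bool, Matrix.single e
    (if τ'.isRed e then τ.next (e, s) else τ.next (τ.next (e, s))).1 (1 : ℝ)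

/-- Finite flip sequences of labelled balanced triangulations; edges may flip simultaneously. -/
inductive FlipSequence {A : Type*} [Fintype A] :
    VeeringTriangulation A → VeeringTriangulation A → Type _
  | nil (τ : VeeringTriangulation A) (hτ : τ.IsBalanced) : FlipSequence τ τ
  | cons (τ : VeeringTriangulation A) (hτ : τ.IsBalanced) (F : Finset A)
      {τ' ω : VeeringTriangulation A} (h : FlipsTo τ F τ') (ζ : FlipSequence τ' ω) :
      FlipSequence τ ω

namespace FlipSequence

variable {A : Type*} [Fintype A]

/-- Concatenation of flip sequences. -/
def append {σ τ ω : VeeringTriangulation A} :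
    FlipSequence σ τ → FlipSequence τ ω → FlipSequence σ ω
  | nil _ _, ζ => ζ
  | cons σ hσ F h γ, ζ => cons σ hσ F h (γ.append ζ)

/-- The matrix `A_γ`, the product of the matrices of the flips of `γ` in order. -/
noncomputable def matrix [DecidableEq A] {σ τ : VeeringTriangulation A} :
    FlipSequence σ τ → Matrix A A ℝ
  | nil _ _ => 1
  | @cons _ _ σ _ F σ' _ _ γ => flipMatrix σ F σ' * γ.matrix

/-- The label `r` is flipped somewhere in the sequence. -/
def Flipped (r : A) {σ τ : VeeringTriangulation A} : FlipSequence σ τ → Prop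
  | nil _ _ => False
  | cons _ _ F _ γ => r ∈ F ∨ γ.Flipped r

/-- The norm `|v_{γ,s}|` of the column of `A_γ` with label `s` (the sum of its entries, which are
non-negative). -/
noncomputable def colNorm [DecidableEq A] {σ τ : VeeringTriangulation A} (γ : FlipSequence σ τ)
    (s : A) : ℝ := ∑ a, γ.matrix a s

/-- The sequence is an initial segment of the flip sequence of the widths `x`: at each stage, all
edges of maximal width are flipped (these are the first edges whose widths become one under the
flow `(x, y) ↦ (e ^ t x, e ^ (-t) y)`), and the resulting widths are positive widths for the new
triangulation, which determines the colours of the flipped edges. -/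
def Follows [DecidableEq A] {σ τ : VeeringTriangulation A} :
    FlipSequence σ τ → (A → ℝ) → Prop
  | nil _ _, _ => True
  | @cons _ _ σ _ F σ' _ _ γ, x => (∀ e, e ∈ F ↔ ∀ a, x a ≤ x e) ∧
      ∃ x' : A → ℝ, x' ∈ σ'.widthCone ∧ (∀ a, 0 < x' a) ∧ x = flipMatrix σ F σ' *ᵥ x' ∧
        γ.Follows x'

/-- The set `H_γ`, the image of `H_τ` under the projective map of `A_γ`. -/
noncomputable def paramSet [DecidableEq A] {σ τ : VeeringTriangulation A}
    (γ : FlipSequence σ τ) : Set (A → ℝ) :=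
  (fun x => simplexProj (γ.matrix *ᵥ x)) '' τ.normWidths

/-- The set `X_{M,r}` of those `x ∈ H_γ` such that `|v_{δ,r}| > M max_s |v_{γ,s}|` for some
extension `δ = γζ` of `γ` along the flip sequence of `x` in which `r` is not flipped after `γ`. As
`|v_{δ,r}|` does not decrease until `r` is flipped, this means that the inequality holds for the
largest such extension whenever that extension is finite.  After `γ`, the widths of
`x = ρ(A_γ x')` have become, up to scale, `x' ∈ H_τ`. -/
noncomputable def growthSet [DecidableEq A] {σ τ : VeeringTriangulation A}
    (γ : FlipSequence σ τ) (M : ℝ) (r : A) : Set (A → ℝ) :=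
  {x | ∃ x' ∈ τ.normWidths, x = simplexProj (γ.matrix *ᵥ x') ∧
    ∃ (ω : VeeringTriangulation A) (ζ : FlipSequence τ ω), ζ.Follows x' ∧ ¬ ζ.Flipped r ∧
      M * (⨆ s, γ.colNorm s) < (γ.append ζ).colNorm r}

end FlipSequence

/-- The `(D - 1)`-dimensional Lebesgue measure on the width polytope of `σ` intersected with the
standard simplex, as a subset of Euclidean space (with the normalisation of the Hausdorff
measure; it only matters up to a constant factor). -/
noncomputable def VeeringTriangulation.lebesgue {A : Type*} [Fintype A]
    (σ : VeeringTriangulation A) (X : Set (A → ℝ)) : ℝ≥0∞ :=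
  (Measure.hausdorffMeasure ((σ.stratumDim : ℝ) - 1) : Measure (EuclideanSpace ℝ A))
    (WithLp.toLp 2 '' X)

/-! Scaling removes the threshold 1 from the definition of balance: `H_τ` is the slice `|x| = 1` of
a convex cone `C_τ`, open in the width space (`normWidths_eq`). Hence `H_γ` is the slice of the
convex cone `A_γ C_τ` (`paramSet_eq`). Put `V = max_s |v_{γ,s}|`.

While `r` is not flipped, its width does not change: `x' = A_ζ y` with `y_r = x'_r`. So `|A_γ x'| =
∑ |v_{γζ,s}| y_s ≥ |v_{γζ,r}| x'_r`, and on the growth set the vector `z = x' / |A_γ x'|` satisfies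
`M V z_r < 1` (`growthSet_subset`): it lies near the face `z_r = 0`.

Only finitely many triangulations exist on a given alphabet, so some `δ > 0` admits in each balanced
cone a point `u` with `|u| = 1` and all coordinates at least `δ`. As `|A_γ u| ≤ V`, the point `v = u
/ |A_γ u|` has `v_r ≥ δ / V`. The homothety of centre `A_γ v` and ratio `1 - 1/(Mδ)` maps `H_γ` into
itself by convexity, and its image misses the growth set. The growth set therefore fills at most the
proportion `1 - (1 - 1/(Mδ))^(D-1) ≤ (D-1)/(Mδ)` of `H_γ`, whatever the distortion of `A_γ`. -/

namespace VeeringTriangulation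

/-! ### Width equations and widest edges -/

variable {A : Type*}

/-- The linear subspace cut out by the width equations. -/
def widthSpace (τ : VeeringTriangulation A) : Submodule ℝ (A → ℝ) where
  carrier := {x | ∀ d, τ.Wide d → x d.1 = x (τ.next d).1 + x (τ.next (τ.next d)).1}
  add_mem' {x y} hx hy d hd := by
    simp only [Pi.add_apply, hx d hd, hy d hd]; ring
  zero_mem' d _ := by simp
  smul_mem' c x hx d hd := by
    simp only [Pi.smul_apply, smul_eq_mul, hx d hd]; ring

theorem ForwardFlippable.wide {τ : VeeringTriangulation A} {d : A × Bool}
    (h : τ.ForwardFlippable d.1) : τ.Wide d := h d.2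

theorem Wide.not_wide_next {τ : VeeringTriangulation A} {d : A × Bool} (h : τ.Wide d) :
    ¬ τ.Wide (τ.next d) := fun h' => by
  have h1 := h.2
  have h2 := h'.1
  rw [h1] at h2
  exact absurd h2 (by decide)

theorem Wide.not_wide_next_next {τ : VeeringTriangulation A} {d : A × Bool} (h : τ.Wide d) :
    ¬ τ.Wide (τ.next (τ.next d)) := fun h' => by
  have h1 := h.1
  have h2 := h'.2
  rw [τ.next_next_next, h1] at h2
  exact absurd h2 (by decide)

end VeeringTriangulation

/-! ### The action of a flip on the width space -/

namespace FlipsTo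

open VeeringTriangulation

variable {A : Type*} {τ τ' : VeeringTriangulation A} {F : Finset A}

/-- A triangle has only one widest edge, so the sides of the quadrilateral of a flipped edge are not
flipped at the same time. -/
theorem next_notMem (h : FlipsTo τ F τ') {d : A × Bool} (hd : τ.Wide d) :
    (τ.next d).1 ∉ F :=
  fun hF => hd.not_wide_next (h.flippable _ hF).wide

theorem next_next_notMem (h : FlipsTo τ F τ') {d : A × Bool} (hd : τ.Wide d) :
    (τ.next (τ.next d)).1 ∉ F :=
  fun hF => hd.not_wide_next_next (h.flippable _ hF).wide

theorem next_eq_of_notMem (h : FlipsTo τ F τ') {d : A × Bool} (h0 : d.1 ∉ F)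
    (h1 : (τ.next d).1 ∉ F) (h2 : (τ.next (τ.next d)).1 ∉ F) :
    τ'.next d = τ.next d ∧ τ'.next (τ.next d) = τ.next (τ.next d) := by
  refine ⟨h.next_other d h0 h1 h2, h.next_other _ h1 h2 ?_⟩
  rwa [τ.next_next_next]

variable [Fintype A] [DecidableEq A]

theorem flipMatrix_mulVec_of_notMem (τ τ' : VeeringTriangulation A) (F : Finset A)
    (x : A → ℝ) {a : A} (ha : a ∉ F) : (flipMatrix τ F τ' *ᵥ x) a = x a := by
  rw [flipMatrix, Matrix.add_mulVec, Matrix.one_mulVec, Pi.add_apply, add_eq_left,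
    Matrix.sum_mulVec, Finset.sum_apply]
  refine Finset.sum_eq_zero fun e he => ?_
  rw [Matrix.sum_mulVec, Finset.sum_apply]
  refine Finset.sum_eq_zero fun s _ => ?_
  rw [Matrix.single_mulVec]
  simp only [Function.update_apply, Pi.zero_apply]
  rw [if_neg]
  rintro rfl
  exact ha he

theorem flipMatrix_mulVec_of_mem (τ τ' : VeeringTriangulation A) (F : Finset A)
    (x : A → ℝ) {e : A} (he : e ∈ F) : (flipMatrix τ F τ' *ᵥ x) e = x e +
      ∑ s : Bool, x (if τ'.isRed e then τ.next (e, s) else τ.next (τ.next (e, s))).1 := by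
  rw [flipMatrix, Matrix.add_mulVec, Matrix.one_mulVec, Pi.add_apply, add_right_inj,
    Matrix.sum_mulVec, Finset.sum_apply, Finset.sum_eq_single_of_mem e he]
  · rw [Matrix.sum_mulVec, Finset.sum_apply]
    refine Finset.sum_congr rfl fun s _ => ?_
    rw [Matrix.single_mulVec]
    simp
  · intro b _ hb
    rw [Matrix.sum_mulVec, Finset.sum_apply]
    refine Finset.sum_eq_zero fun s _ => ?_
    rw [Matrix.single_mulVec]
    simp [hb.symm]

theorem one_le_flipMatrix (τ τ' : VeeringTriangulation A) (F : Finset A) (a b : A) :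
    (1 : Matrix A A ℝ) a b ≤ flipMatrix τ F τ' a b := by
  rw [flipMatrix, Matrix.add_apply, le_add_iff_nonneg_right, Matrix.sum_apply]
  refine Finset.sum_nonneg fun e _ => ?_
  rw [Matrix.sum_apply]
  refine Finset.sum_nonneg fun s _ => ?_
  rw [Matrix.single_apply]
  split_ifs <;> norm_num

/-- The matrix is `1 + N` with `N ^ 2 = 0`: the rows of `N` are indexed by flipped edges, its
columns by sides of their quadrilaterals, and the latter are never flipped. -/
theorem isUnit_flipMatrix (h : FlipsTo τ F τ') : IsUnit (flipMatrix τ F τ') := by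
  have hN : ∀ e ∈ F, ∀ e' ∈ F, ∀ s s' : Bool,
      Matrix.single e (if τ'.isRed e then τ.next (e, s) else τ.next (τ.next (e, s))).1 (1 : ℝ) *
      Matrix.single e' (if τ'.isRed e' then τ.next (e', s') else τ.next (τ.next (e', s'))).1
        (1 : ℝ) = 0 := by
    intro e he e' he' s s'
    apply Matrix.single_mul_single_of_ne
    rintro rfl
    have hw : τ.Wide (e, s) := h.flippable e he s
    split_ifs at he'
    · exact h.next_notMem hw he'
    · exact h.next_next_notMem hw he'
  refine IsNilpotent.isUnit_one_add ⟨2, ?_⟩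
  rw [pow_two, Finset.sum_mul_sum]
  refine Finset.sum_eq_zero fun e he => Finset.sum_eq_zero fun e' he' => ?_
  rw [Finset.sum_mul_sum]
  exact Finset.sum_eq_zero fun s _ => Finset.sum_eq_zero fun s' _ => hN e he e' he' s s'

/-- The width equation of a triangle at the flipped edge `e` before the flip is equivalent to that of
a triangle at `e` after the flip. -/
theorem width_eq_iff (τ τ' : VeeringTriangulation A) {F : Finset A} {e : A} (he : e ∈ F) (s : Bool) (x : A → ℝ) :
    (flipMatrix τ F τ' *ᵥ x) e = x (τ.next (e, s)).1 + x (τ.next (τ.next (e, s))).1 ↔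
      if τ'.isRed e then x (τ.next (τ.next (e, s))).1 = x (τ.next (e, !s)).1 + x e
      else x (τ.next (e, s)).1 = x e + x (τ.next (τ.next (e, !s))).1 := by
  rw [flipMatrix_mulVec_of_mem _ _ _ _ he]
  cases s <;> split_ifs <;> simp only [Fintype.sum_bool, Bool.not_false, Bool.not_true] <;>
    constructor <;> intro <;> linarith

/-- Triangles away from `F` keep their edges and colours. At a flipped edge the two old equations
match the two new ones by `width_eq_iff`; the colour of the new diagonal decides which side is
widest. -/
theorem mulVec_mem_widthSpace_iff (h : FlipsTo τ F τ') (x : A → ℝ) :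
    flipMatrix τ F τ' *ᵥ x ∈ τ.widthSpace ↔ x ∈ τ'.widthSpace := by
  have hout : ∀ {a}, a ∉ F → (flipMatrix τ F τ' *ᵥ x) a = x a :=
    fun ha => flipMatrix_mulVec_of_notMem τ τ' F x ha
  constructor
  · intro hx d hd
    have key : ∀ e ∈ F, ∀ s, if τ'.isRed e then
        x (τ.next (τ.next (e, s))).1 = x (τ.next (e, !s)).1 + x e
        else x (τ.next (e, s)).1 = x e + x (τ.next (τ.next (e, !s))).1 := by
      intro e he s
      have hw : τ.Wide (e, s) := h.flippable e he s
      rw [← width_eq_iff τ τ' he s, ← hout (h.next_notMem hw), ← hout (h.next_next_notMem hw)]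
      exact hx _ hw
    -- A new diagonal is followed by a red side, so it is never widest.
    by_cases h0 : d.1 ∈ F
    · exfalso
      obtain ⟨e, s⟩ := d
      have h1 := hd.1
      have hw : τ.Wide (e, s) := h.flippable e h0 s
      rw [h.next_diag e h0 s, h.colour _ (h.next_next_notMem hw), hw.2] at h1
      exact absurd h1 (by decide)
    -- Here `d` is a red side of the quadrilateral, widest afterwards only if the new diagonal is
    -- red.
    by_cases h1 : (τ.next d).1 ∈ F
    · obtain ⟨⟨e, s⟩, hes⟩ : ∃ f, τ.next d = f := ⟨_, rfl⟩
      have hd' : d = τ.next (τ.next (e, s)) := by rw [← hes, τ.next_next_next]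
      rw [hes] at h1
      have e1 : τ'.next d = τ.next (e, !s) := by rw [hd', h.next_side e h1 s]
      have e2 : τ'.next (τ'.next d) = (e, s) := by rw [e1, h.next_side' e h1 s]
      have hr : τ'.isRed e = true := by have := hd.2; rwa [e2] at this
      have := key e h1 s
      rw [if_pos hr] at this
      rw [e2, e1, hd']
      exact this
    -- Here `d` is a blue side, widest afterwards only if the new diagonal is blue.
    by_cases h2 : (τ.next (τ.next d)).1 ∈ F
    · obtain ⟨⟨e, s⟩, hes⟩ : ∃ f, τ.next (τ.next d) = f := ⟨_, rfl⟩
      have hd' : d = τ.next (e, s) := by rw [← hes, τ.next_next_next]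
      rw [hes] at h2
      have e1 : τ'.next d = (e, !s) := by
        have := h.next_side' e h2 (!s)
        rwa [Bool.not_not, ← hd'] at this
      have e2 : τ'.next (τ'.next d) = τ.next (τ.next (e, !s)) := by
        rw [e1, h.next_diag e h2]
      have hr : ¬ τ'.isRed e = true := by
        have := hd.1
        rw [e1] at this
        simp [this]
      have := key e h2 s
      rw [if_neg hr] at this
      rw [e2, e1, hd']
      exact this
    · obtain ⟨e1, e2⟩ := h.next_eq_of_notMem h0 h1 h2
      have hw : τ.Wide d := by
        have := hd
        unfold Wide at this
        rwa [e1, e2, h.colour _ h1, h.colour _ h2] at this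
      rw [e1, e2, ← hout h0, ← hout h1, ← hout h2]
      exact hx d hw
  · intro hx d hd
    have h1 := h.next_notMem hd
    have h2 := h.next_next_notMem hd
    by_cases h0 : d.1 ∈ F
    · obtain ⟨e, s⟩ := d
      rw [hout h1, hout h2]
      refine (width_eq_iff τ τ' h0 s x).2 ?_
      have hw : τ.Wide (e, !s) := h.flippable e h0 _
      have h1' := h.next_notMem hw
      have h2' := h.next_next_notMem hw
      split_ifs with hr
      · have e1 := h.next_side e h0 s
        have e2 := h.next_side' e h0 s
        have := hx (τ.next (τ.next (e, s)))
        rw [e1, e2] at this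
        exact this ⟨by rw [e1, h.colour _ h1', hw.1], by rw [e1, e2]; exact hr⟩
      · have e1 : τ'.next (τ.next (e, s)) = (e, !s) := by
          have := h.next_side' e h0 (!s)
          rwa [Bool.not_not] at this
        have e2 := h.next_diag e h0 (!s)
        have := hx (τ.next (e, s))
        rw [e1, e2] at this
        exact this ⟨by rw [e1]; simpa using hr, by rw [e1, e2, h.colour _ h2', hw.2]⟩
    · obtain ⟨e1, e2⟩ := h.next_eq_of_notMem h0 h1 h2
      rw [hout h0, hout h1, hout h2]
      have := hx d
      rw [e1, e2] at this
      refine this ?_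
      unfold Wide
      rw [e1, e2, h.colour _ h1, h.colour _ h2]
      exact hd

end FlipsTo

/-! ### Matrices of flip sequences and their column norms -/

namespace FlipSequence

open VeeringTriangulation

variable {A : Type*} [Fintype A] {σ τ ω : VeeringTriangulation A}

theorem isBalanced_left (γ : FlipSequence σ τ) : σ.IsBalanced := by
  cases γ <;> assumption

theorem isBalanced_right (γ : FlipSequence σ τ) : τ.IsBalanced := by
  induction γ <;> assumption

variable [DecidableEq A]

theorem matrix_append (γ : FlipSequence σ τ) (ζ : FlipSequence τ ω) :
    (γ.append ζ).matrix = γ.matrix * ζ.matrix := by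
  induction γ with
  | nil => simp [append, matrix]
  | cons σ hσ F h γ ih => simp [append, matrix, ih, Matrix.mul_assoc]

theorem isUnit_matrix (γ : FlipSequence σ τ) : IsUnit γ.matrix := by
  induction γ with
  | nil => exact isUnit_one
  | cons σ hσ F h γ ih => exact h.isUnit_flipMatrix.mul ih

theorem mulVec_mem_widthSpace_iff (γ : FlipSequence σ τ) (x : A → ℝ) :
    γ.matrix *ᵥ x ∈ σ.widthSpace ↔ x ∈ τ.widthSpace := by
  induction γ with
  | nil => simp [matrix]
  | cons σ hσ F h γ ih =>
    rw [matrix, ← Matrix.mulVec_mulVec, h.mulVec_mem_widthSpace_iff, ih]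

theorem one_le_matrix (γ : FlipSequence σ τ) (a b : A) :
    (1 : Matrix A A ℝ) a b ≤ γ.matrix a b := by
  induction γ generalizing a b with
  | nil => exact le_rfl
  | @cons σ hσ F σ' _ h γ ih =>
    have h0 : ∀ i j, (0 : ℝ) ≤ (1 : Matrix A A ℝ) i j := fun i j => by
      rw [Matrix.one_apply]; split_ifs <;> norm_num
    have hF := FlipsTo.one_le_flipMatrix σ σ' F
    rw [matrix, Matrix.mul_apply]
    calc (1 : Matrix A A ℝ) a b = 1 * (1 : Matrix A A ℝ) a b := (one_mul _).symm
      _ ≤ flipMatrix σ F σ' a a * γ.matrix a b :=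
        mul_le_mul (by simpa using hF a a) (ih a b) (h0 _ _) ((h0 _ _).trans (hF _ _))
      _ ≤ _ := by
        refine Finset.single_le_sum (f := fun j => flipMatrix σ F σ' a j * γ.matrix j b)
          (fun j _ => ?_) (Finset.mem_univ a)
        exact mul_nonneg ((h0 _ _).trans (hF _ _)) ((h0 _ _).trans (ih _ _))

/-- Each flip matrix fixes the coordinates of unflipped labels, so the width of `r` survives along
the whole sequence. -/
theorem Follows.exists_mulVec_eq {γ : FlipSequence σ τ} {x : A → ℝ} (h : γ.Follows x)
    (hx : ∀ a, 0 < x a) {r : A} (hr : ¬ γ.Flipped r) :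
    ∃ y : A → ℝ, (∀ a, 0 < y a) ∧ x = γ.matrix *ᵥ y ∧ y r = x r := by
  induction γ generalizing x with
  | nil => exact ⟨x, hx, by simp [matrix], rfl⟩
  | cons σ hσ F hF γ ih =>
    obtain ⟨-, x', -, hx', rfl, hf⟩ := h
    rw [Flipped, not_or] at hr
    obtain ⟨y, hy, rfl, hyr⟩ := ih hf hx' hr.2
    refine ⟨y, hy, by rw [matrix, Matrix.mulVec_mulVec], ?_⟩
    rw [FlipsTo.flipMatrix_mulVec_of_notMem _ _ _ _ hr.1, hyr]

theorem sum_mulVec_eq (γ : FlipSequence σ τ) (x : A → ℝ) :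
    ∑ a, (γ.matrix *ᵥ x) a = ∑ s, γ.colNorm s * x s := by
  simp only [Matrix.mulVec, dotProduct, colNorm, Finset.sum_mul]
  exact Finset.sum_comm

theorem one_le_colNorm (γ : FlipSequence σ τ) (s : A) : 1 ≤ γ.colNorm s := by
  have h0 : ∀ i j, (0 : ℝ) ≤ (1 : Matrix A A ℝ) i j := fun i j => by
    rw [Matrix.one_apply]; split_ifs <;> norm_num
  calc (1 : ℝ) ≤ γ.matrix s s := by simpa using γ.one_le_matrix s s
    _ ≤ _ := Finset.single_le_sum (f := fun a => γ.matrix a s)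
      (fun a _ => (h0 _ _).trans (γ.one_le_matrix a s)) (Finset.mem_univ s)

theorem colNorm_le_iSup (γ : FlipSequence σ τ) (s : A) : γ.colNorm s ≤ ⨆ s, γ.colNorm s :=
  le_ciSup (Set.finite_range _).bddAbove s

theorem sum_mulVec_pos [Nonempty A] (γ : FlipSequence σ τ) {x : A → ℝ} (hx : ∀ a, 0 < x a) :
    0 < ∑ a, (γ.matrix *ᵥ x) a := by
  rw [sum_mulVec_eq]
  exact Finset.sum_pos (fun s _ => mul_pos (one_pos.trans_le (γ.one_le_colNorm s)) (hx s))
    Finset.univ_nonempty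

theorem sum_mulVec_le (γ : FlipSequence σ τ) {x : A → ℝ} (hx : ∀ a, 0 < x a) :
    ∑ a, (γ.matrix *ᵥ x) a ≤ (⨆ s, γ.colNorm s) * ∑ a, x a := by
  rw [sum_mulVec_eq, Finset.mul_sum]
  exact Finset.sum_le_sum fun s _ => mul_le_mul_of_nonneg_right (γ.colNorm_le_iSup s) (hx s).le

/-- Along the flip sequence of `x`, a column that has grown by a factor `M` while its label was not
flipped forces the corresponding width to be small. -/
theorem mul_lt_sum_mulVec (γ : FlipSequence σ τ) {ζ : FlipSequence τ ω} {x : A → ℝ}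
    (h : ζ.Follows x) (hx : ∀ a, 0 < x a) {r : A} (hr : ¬ ζ.Flipped r) {M : ℝ}
    (hM : M * (⨆ s, γ.colNorm s) < (γ.append ζ).colNorm r) :
    M * (⨆ s, γ.colNorm s) * x r < ∑ a, (γ.matrix *ᵥ x) a := by
  obtain ⟨y, hy, rfl, hyr⟩ := h.exists_mulVec_eq hx hr
  -- The total is now the sum over `s` of `|v_{γζ,s}| y_s`; the term `s = r` alone suffices.
  rw [Matrix.mulVec_mulVec, ← matrix_append, sum_mulVec_eq, ← hyr]
  refine (mul_lt_mul_of_pos_right hM (hy r)).trans_le ?_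
  exact Finset.single_le_sum (f := fun s => (γ.append ζ).colNorm s * y s)
    (fun s _ => mul_nonneg (zero_le_one.trans (one_le_colNorm _ s)) (hy s).le)
    (Finset.mem_univ r)

end FlipSequence

/-! ### Normalised widths as a slice of a convex cone -/

namespace VeeringTriangulation

variable {A : Type*}

theorem backWidth_add (τ : VeeringTriangulation A) (x y : A → ℝ) (f : A) :
    τ.backWidth (x + y) f = τ.backWidth x f + τ.backWidth y f := by
  simp only [backWidth, Pi.add_apply, Finset.sum_add_distrib]; ring

theorem backWidth_smul (τ : VeeringTriangulation A) (c : ℝ) (x : A → ℝ) (f : A) :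
    τ.backWidth (c • x) f = c * τ.backWidth x f := by
  simp only [backWidth, Pi.smul_apply, smul_eq_mul, ← Finset.mul_sum]; ring

theorem continuous_backWidth (τ : VeeringTriangulation A) (f : A) :
    Continuous fun x => τ.backWidth x f := by
  unfold backWidth; fun_prop

/-- The linear strict inequalities satisfied by the widths for which some multiple is balanced and
lies in the upper boundary. -/
def balancedRegion (τ : VeeringTriangulation A) : Set (A → ℝ) :=
  {x | (∀ a, 0 < x a) ∧
    ∀ e f, τ.ForwardFlippable e → τ.BackwardFlippable f → x e < τ.backWidth x f}

/-- The cone spanned by `H_τ`. -/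
def balancedCone (τ : VeeringTriangulation A) : Set (A → ℝ) :=
  τ.balancedRegion ∩ τ.widthSpace

theorem isOpen_balancedRegion [Finite A] (τ : VeeringTriangulation A) :
    IsOpen τ.balancedRegion := by
  simp only [balancedRegion, Set.ofPred_and, Set.ofPred_forall]
  refine IsOpen.inter (isOpen_iInter_of_finite fun a => ?_)
    (isOpen_iInter_of_finite fun e => isOpen_iInter_of_finite fun f => isOpen_iInter_of_finite
      fun _ => isOpen_iInter_of_finite fun _ => ?_)
  · exact isOpen_lt continuous_const (continuous_apply a)
  · exact isOpen_lt (continuous_apply e) (τ.continuous_backWidth f)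

theorem smul_mem_balancedCone {τ : VeeringTriangulation A} {x : A → ℝ}
    (hx : x ∈ τ.balancedCone) {c : ℝ} (hc : 0 < c) : c • x ∈ τ.balancedCone := by
  refine ⟨⟨fun a => mul_pos hc (hx.1.1 a), fun e f he hf => ?_⟩,
    τ.widthSpace.smul_mem c hx.2⟩
  rw [backWidth_smul]
  exact mul_lt_mul_of_pos_left (hx.1.2 e f he hf) hc

theorem add_mem_balancedCone {τ : VeeringTriangulation A} {x y : A → ℝ}
    (hx : x ∈ τ.balancedCone) (hy : y ∈ τ.balancedCone) : x + y ∈ τ.balancedCone := by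
  refine ⟨⟨fun a => add_pos (hx.1.1 a) (hy.1.1 a), fun e f he hf => ?_⟩,
    τ.widthSpace.add_mem hx.2 hy.2⟩
  rw [backWidth_add]
  exact add_lt_add (hx.1.2 e f he hf) (hy.1.2 e f he hf)

/-- Every triangle has a widest edge. -/
theorem exists_wide (τ : VeeringTriangulation A) (d : A × Bool) :
    τ.Wide d ∨ τ.Wide (τ.next d) ∨ τ.Wide (τ.next (τ.next d)) := by
  have := τ.triangle_colours d
  simp only [Wide, τ.next_next_next]
  cases h0 : τ.isRed d.1 <;> cases h1 : τ.isRed (τ.next d).1 <;>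
    cases h2 : τ.isRed (τ.next (τ.next d)).1 <;> simp_all

/-- If another side were widest, its width would exceed that of `d` by a positive summand. -/
theorem wide_of_forall_le {τ : VeeringTriangulation A} {x : A → ℝ} (hx : x ∈ τ.widthSpace)
    (hpos : ∀ a, 0 < x a) {d : A × Bool} (hd : ∀ a, x a ≤ x d.1) : τ.Wide d := by
  rcases τ.exists_wide d with h | h | h
  · exact h
  · have h' := hx _ h
    rw [τ.next_next_next] at h'
    linarith [hd (τ.next d).1, hpos (τ.next (τ.next d)).1]
  · have h' := hx _ h
    rw [τ.next_next_next] at h'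
    linarith [hd (τ.next (τ.next d)).1, hpos (τ.next d).1]

/-- An edge of maximal width is forward flippable. -/
theorem exists_forwardFlippable [Finite A] [Nonempty A] {τ : VeeringTriangulation A} {x : A → ℝ}
    (hx : x ∈ τ.widthSpace) (hpos : ∀ a, 0 < x a) :
    ∃ e, τ.ForwardFlippable e ∧ ∀ a, x a ≤ x e := by
  obtain ⟨e, he⟩ := Finite.exists_max x
  exact ⟨e, fun s => wide_of_forall_le hx hpos he, he⟩

variable [Fintype A]

theorem area_smul (τ : VeeringTriangulation A) (x y : A → ℝ) (c : ℝ) :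
    τ.area x (c • y) = c * τ.area x y := by
  simp only [area, Finset.mul_sum]
  refine Finset.sum_congr rfl fun d _ => ?_
  split_ifs <;> (try simp only [Pi.smul_apply, smul_eq_mul]) <;> ring

/-- Substituting `x_e = x_a + x_b` turns the contribution of a triangle into `(x_b y_a + x_a y_b) /
2`. Positivity lets heights be rescaled to unit area. -/
theorem area_pos [Nonempty A] {τ : VeeringTriangulation A} {x y : A → ℝ}
    (hx : x ∈ τ.widthSpace) (hpos : ∀ a, 0 < x a) (hy : ∀ a, 0 < y a) : 0 < τ.area x y := by
  have key : ∀ d, τ.Wide d → 0 < (if τ.Wide d then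
    (let e := d.1
     let a := if τ.isRed d.1 then (τ.next d).1 else (τ.next (τ.next d)).1
     let b := if τ.isRed d.1 then (τ.next (τ.next d)).1 else (τ.next d).1
     (x e * y a + x a * y b - x a * y a) / 2)
     else 0) := by
    intro d hd
    rw [if_pos hd]
    have h := hx d hd
    dsimp only
    have h1 := mul_pos (hpos (τ.next d).1) (hy (τ.next (τ.next d)).1)
    have h2 := mul_pos (hpos (τ.next (τ.next d)).1) (hy (τ.next d).1)
    have h3 := mul_pos (hpos (τ.next d).1) (hy (τ.next d).1)
    have h4 := mul_pos (hpos (τ.next (τ.next d)).1) (hy (τ.next (τ.next d)).1)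
    split_ifs <;> rw [h] <;> ring_nf at * <;> linarith
  obtain ⟨e, he, -⟩ := exists_forwardFlippable hx hpos
  refine Finset.sum_pos' (fun d _ => ?_) ⟨(e, true), Finset.mem_univ _, key _ (he true)⟩
  by_cases hd : τ.Wide d
  · exact (key d hd).le
  · rw [if_neg hd]

/-- Without edges the formula for `D` gives 1 (the abelian condition is vacuous), but the width cone
spans dimension 0, so the triangulation is not core. -/
theorem IsBalanced.nonempty {τ : VeeringTriangulation A} (hτ : τ.IsBalanced) : Nonempty A := by
  by_contra hA
  rw [not_nonempty_iff] at hA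
  have h := hτ.1.1
  have h1 : τ.IsAbelian := ⟨fun _ => true, fun d => isEmptyElim d.1, fun d => isEmptyElim d.1⟩
  have h2 : Nat.card (Quotient (Equiv.Perm.SameCycle.setoid τ.next)) = 0 := by
    simp
  rw [Module.finrank_zero_of_subsingleton, stratumDim, if_pos h1, eulerChar, numTriangles, h2]
    at h
  simp at h

theorem IsBalanced.exists_mem_balancedParams {τ : VeeringTriangulation A} (hτ : τ.IsBalanced) :
    ∃ x y, x ∈ τ.balancedCone ∧ y ∈ τ.heightCone ∧ ∀ a, 0 < y a := by
  obtain ⟨-, p, ⟨⟨hx, hy, hx0, hy0, -⟩, h1, h2⟩, -⟩ := hτ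
  exact ⟨p.1, p.2, ⟨⟨hx0, fun e f he hf => (h1 e he).trans_lt (h2 f hf)⟩, hx.2⟩, hy, hy0⟩

theorem simplexProj_smul {x : A → ℝ} {c : ℝ} (hc : 0 < c) :
    simplexProj (c • x) = simplexProj x := by
  simp only [simplexProj, Pi.smul_apply, smul_eq_mul, ← Finset.mul_sum, smul_smul, mul_inv]
  congr 1
  field_simp

theorem sum_simplexProj {x : A → ℝ} (hx : 0 < ∑ a, x a) : ∑ a, simplexProj x a = 1 := by
  simp only [simplexProj, Pi.smul_apply, smul_eq_mul, ← Finset.mul_sum]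
  exact inv_mul_cancel₀ hx.ne'

theorem simplexProj_eq_self {x : A → ℝ} (hx : ∑ a, x a = 1) : simplexProj x = x := by
  simp [simplexProj, hx]

/-- Balance gives `x e ≤ 1 < backWidth x f`, whose homogeneous consequence defines the cone.
Conversely, divide by the maximal width: it is attained at a forward flippable edge, which then has
width one, and every other condition follows. -/
theorem IsBalanced.normWidths_eq {τ : VeeringTriangulation A} (hτ : τ.IsBalanced) :
    τ.normWidths = {x | x ∈ τ.balancedCone ∧ ∑ a, x a = 1} := by
  have := hτ.nonempty
  ext x
  constructor
  · rintro ⟨p, ⟨⟨⟨hx, -, hx0, -, -⟩, h1, h2⟩, -⟩, rfl⟩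
    have hs : 0 < ∑ a, p.1 a := Finset.sum_pos (fun a _ => hx0 a) Finset.univ_nonempty
    exact ⟨smul_mem_balancedCone
      ⟨⟨hx0, fun e f he hf => (h1 e he).trans_lt (h2 f hf)⟩, hx.2⟩ (inv_pos.2 hs),
      sum_simplexProj hs⟩
  · rintro ⟨hx, hs⟩
    obtain ⟨e, he, hmax⟩ := exists_forwardFlippable hx.2 hx.1.1
    obtain ⟨-, y, -, hy, hy0⟩ := hτ.exists_mem_balancedParams
    have hc : 0 < (x e)⁻¹ := inv_pos.2 (hx.1.1 e)
    obtain ⟨z, hz⟩ : ∃ z, z = (x e)⁻¹ • x := ⟨_, rfl⟩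
    have hzC : z ∈ τ.balancedCone := hz ▸ smul_mem_balancedCone hx hc
    have hze : z e = 1 := by simp [hz, (hx.1.1 e).ne']
    have hzle : ∀ a, z a ≤ 1 := fun a => by
      rw [← hze, hz]
      exact mul_le_mul_of_nonneg_left (hmax a) hc.le
    have hA := area_pos hzC.2 hzC.1.1 hy0
    refine ⟨(z, (τ.area z y)⁻¹ • y), ⟨⟨⟨⟨fun a => (hzC.1.1 a).le, hzC.2⟩,
      ⟨fun a => mul_nonneg (inv_nonneg.2 hA.le) (hy.1 a), fun d hd => ?_⟩, hzC.1.1,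
      fun a => mul_pos (inv_pos.2 hA) (hy0 a), ?_⟩,
      fun a _ => hzle a, fun f hf => ?_⟩, e, he, hze⟩, ?_⟩
    · simp only [Pi.smul_apply, smul_eq_mul, hy.2 d hd]; ring
    · rw [area_smul, inv_mul_cancel₀ hA.ne']
    · rw [← hze]
      exact hzC.1.2 e f he hf
    · dsimp only
      rw [hz, simplexProj_smul hc, simplexProj_eq_self hs]

/-- The width cone spans the space of solutions of the width equations as soon as it contains a
positive point. -/
theorem span_widthCone {τ : VeeringTriangulation A} {p : A → ℝ} (hp : p ∈ τ.widthSpace)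
    (hp0 : ∀ a, 0 < p a) : Submodule.span ℝ τ.widthCone = τ.widthSpace := by
  refine le_antisymm (Submodule.span_le.2 fun x hx => hx.2) fun x hx => ?_
  -- A large multiple of the positive point `p` pushes `x` into the cone, and `x` is the difference.
  obtain ⟨t, ht⟩ : ∃ t : ℝ, ∀ a, 0 ≤ t * p a + x a := by
    rcases isEmpty_or_nonempty A with hA | hA
    · exact ⟨0, fun a => isEmptyElim a⟩
    obtain ⟨b, hb⟩ := Finite.exists_max fun a => -x a / p a
    exact ⟨_, fun a => by have := (div_le_iff₀ (hp0 a)).1 (hb a); linarith⟩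
  have h1 : p ∈ Submodule.span ℝ τ.widthCone :=
    Submodule.subset_span ⟨fun a => (hp0 a).le, hp⟩
  have h2 : t • p + x ∈ Submodule.span ℝ τ.widthCone :=
    Submodule.subset_span ⟨ht, τ.widthSpace.add_mem (τ.widthSpace.smul_mem t hp) hx⟩
  have h3 := Submodule.sub_mem _ h2 (Submodule.smul_mem _ t h1)
  rwa [add_sub_cancel_left] at h3

instance : Finite (VeeringTriangulation A) := by
  refine Finite.of_injective (β := Equiv.Perm (A × Bool) × (A → Bool))
    (fun τ => (τ.next, τ.isRed)) fun τ τ' h => ?_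
  cases τ; cases τ'
  simp only [Prod.mk.injEq] at h
  simp [h.1, h.2]

/-- A uniform lower bound for the coordinates of suitable normalised widths. -/
theorem exists_uniform_lower_bound (A : Type*) [Fintype A] :
    ∃ δ : ℝ, 0 < δ ∧ ∀ τ : VeeringTriangulation A, τ.IsBalanced →
      ∃ u ∈ τ.balancedCone, ∑ a, u a = 1 ∧ ∀ a, δ ≤ u a := by
  have key : ∀ τ : VeeringTriangulation A, ∃ δ : ℝ, 0 < δ ∧ (τ.IsBalanced →
      ∃ u ∈ τ.balancedCone, ∑ a, u a = 1 ∧ ∀ a, δ ≤ u a) := by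
    intro τ
    by_cases hτ : τ.IsBalanced
    · have := hτ.nonempty
      obtain ⟨x, -, hx, -, -⟩ := hτ.exists_mem_balancedParams
      have hs : 0 < ∑ a, x a := Finset.sum_pos (fun a _ => hx.1.1 a) Finset.univ_nonempty
      have hu : simplexProj x ∈ τ.balancedCone := smul_mem_balancedCone hx (inv_pos.2 hs)
      obtain ⟨b, hb⟩ := Finite.exists_min (simplexProj x)
      exact ⟨simplexProj x b, hu.1.1 b, fun _ => ⟨_, hu, sum_simplexProj hs, hb⟩⟩
    -- A default value, so that the minimum can be taken over all triangulations on `A`.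
    · exact ⟨1, one_pos, fun h => absurd h hτ⟩
  choose δ hδ h using key
  rcases isEmpty_or_nonempty (VeeringTriangulation A) with hV | hV
  · exact ⟨1, one_pos, fun τ => isEmptyElim τ⟩
  obtain ⟨τ₀, h0⟩ := Finite.exists_min δ
  refine ⟨δ τ₀, hδ τ₀, fun τ hτ => ?_⟩
  obtain ⟨u, hu, hs, hu'⟩ := h τ hτ
  exact ⟨u, hu, hs, fun a => (h0 τ).trans (hu' a)⟩

end VeeringTriangulation

/-! ### The parameter set and the growth set in linear terms -/

namespace FlipSequence

open VeeringTriangulation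

variable {A : Type*} [Fintype A] [DecidableEq A] {σ τ : VeeringTriangulation A}

theorem paramSet_eq (γ : FlipSequence σ τ) :
    γ.paramSet = {x | (∃ z ∈ τ.balancedCone, γ.matrix *ᵥ z = x) ∧ ∑ a, x a = 1} := by
  have := γ.isBalanced_right.nonempty
  rw [paramSet, γ.isBalanced_right.normWidths_eq]
  ext x
  constructor
  · rintro ⟨z, ⟨hz, -⟩, rfl⟩
    have hs := γ.sum_mulVec_pos hz.1.1
    exact ⟨⟨_, smul_mem_balancedCone hz (inv_pos.2 hs), Matrix.mulVec_smul _ _ _⟩,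
      sum_simplexProj hs⟩
  · rintro ⟨⟨z, hz, rfl⟩, hs⟩
    have hz0 : 0 < ∑ a, z a := Finset.sum_pos (fun a _ => hz.1.1 a) Finset.univ_nonempty
    refine ⟨simplexProj z, ⟨smul_mem_balancedCone hz (inv_pos.2 hz0), sum_simplexProj hz0⟩, ?_⟩
    dsimp only
    rw [simplexProj.eq_1 z, Matrix.mulVec_smul, simplexProj_smul (inv_pos.2 hz0),
      simplexProj_eq_self hs]

/-- Rescaling to `|A_γ z| = 1` in `mul_lt_sum_mulVec` leaves a linear condition on `z` that no
longer involves the continuation `ζ`. -/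
theorem growthSet_subset (γ : FlipSequence σ τ) {M : ℝ} (r : A) :
    γ.growthSet M r ⊆ {x | ∃ z ∈ τ.balancedCone, γ.matrix *ᵥ z = x ∧ ∑ a, x a = 1 ∧
      M * (⨆ s, γ.colNorm s) * z r < 1} := by
  have := γ.isBalanced_right.nonempty
  rintro x ⟨z, hz, rfl, ω, ζ, hf, hr, hM⟩
  rw [γ.isBalanced_right.normWidths_eq] at hz
  have hs := γ.sum_mulVec_pos hz.1.1.1
  refine ⟨_, smul_mem_balancedCone hz.1 (inv_pos.2 hs), Matrix.mulVec_smul _ _ _,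
    sum_simplexProj hs, ?_⟩
  have h := γ.mul_lt_sum_mulVec hf hz.1.1.1 hr hM
  rw [Pi.smul_apply, smul_eq_mul, mul_left_comm, inv_mul_lt_one₀ hs]
  exact h

end FlipSequence

/-! ### Hausdorff measure in affine subspaces and under homotheties -/

/-- A bounded subset of an affine subspace which contains a relative neighbourhood of a point has
positive and finite Hausdorff measure in the dimension of the subspace. -/
theorem hausdorffMeasure_pos_and_lt_top {E : Type*} [NormedAddCommGroup E] [NormedSpace ℝ E]
    [FiniteDimensional ℝ E] [MeasurableSpace E] [BorelSpace E] {V : Submodule ℝ E} {p : E}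
    {S U : Set E} (hSV : ∀ x ∈ S, x - p ∈ V) (hS : Bornology.IsBounded S) (hU : IsOpen U)
    (hp : p ∈ U) (hUS : ∀ x ∈ U, x - p ∈ V → x ∈ S) :
    0 < (Measure.hausdorffMeasure (Module.finrank ℝ V) : Measure E) S ∧
      (Measure.hausdorffMeasure (Module.finrank ℝ V) : Measure E) S < ∞ := by
  set n := Module.finrank ℝ V with hn
  have hn0 : (0 : ℝ) ≤ n := Nat.cast_nonneg n
  have hvol : (Measure.hausdorffMeasure (n : ℝ) : Measure (Fin n → ℝ)) = volume := by
    rw [← hausdorffMeasure_pi_real, Fintype.card_fin]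
  let L : (Fin n → ℝ) ≃L[ℝ] V := ContinuousLinearEquiv.ofFinrankEq (by simp [hn])
  -- A bi-Lipschitz chart of `p + V`; on its source the `n`-dimensional Hausdorff measure is
  -- Lebesgue measure.
  let φ : (Fin n → ℝ) → E := fun t => p + (L t : E)
  have hiso : Isometry fun v : V => p + (v : E) :=
    (isometry_add_left p).comp V.subtypeₗᵢ.isometry
  have hlip := hiso.lipschitz.comp L.lipschitz
  have hanti := hiso.antilipschitz.comp L.antilipschitz
  have hφ : (fun v : V => p + (v : E)) ∘ L = φ := rfl
  rw [hφ] at hlip hanti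
  have hSφ : S = φ '' (φ ⁻¹' S) := by
    refine (Set.image_preimage_eq_of_subset fun x hx => ?_).symm
    exact ⟨L.symm ⟨x - p, hSV x hx⟩, by simp [φ]⟩
  constructor
  · have hopen : IsOpen (φ ⁻¹' U) := hU.preimage hlip.continuous
    have h0 : (0 : Fin n → ℝ) ∈ φ ⁻¹' U := by simpa [φ] using hp
    have hpos := hopen.measure_pos volume ⟨0, h0⟩
    have hsub : φ ⁻¹' U ⊆ φ ⁻¹' S := fun t ht => hUS _ ht (by simp [φ])
    have hle := hanti.hausdorffMeasure_preimage_le hn0 S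
    rw [hvol] at hle
    by_contra h
    rw [not_lt, nonpos_iff_eq_zero] at h
    rw [h, mul_zero] at hle
    exact absurd (hpos.trans_le ((measure_mono hsub).trans hle)) (lt_irrefl 0)
  · have hb : Bornology.IsBounded (φ ⁻¹' S) := hanti.isBounded_preimage hS
    have hle := hlip.hausdorffMeasure_image_le hn0 (φ ⁻¹' S)
    rw [hvol, ← hSφ] at hle
    exact hle.trans_lt (ENNReal.mul_lt_top
      (ENNReal.rpow_lt_top_of_nonneg hn0 ENNReal.coe_ne_top) hb.measure_lt_top)

/-- If a homothety of ratio `c` maps `S` into `S \ X`, then `X` fills at most the proportion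
`1 - c ^ n ≤ n (1 - c)` of `S`. -/
theorem hausdorffMeasure_le_of_homothety {E : Type*} [NormedAddCommGroup E] [NormedSpace ℝ E]
    [MeasurableSpace E] [BorelSpace E] {S X : Set E} {p : E} {n : ℕ} {c : ℝ} (hc : 0 < c)
    (hS : MeasurableSet S) (hfin : (Measure.hausdorffMeasure n : Measure E) S < ∞)
    (hX : X ⊆ S) (hmaps : ∀ x ∈ S, AffineMap.homothety p c x ∈ S \ X) :
    (Measure.hausdorffMeasure n : Measure E) X ≤
      ENNReal.ofReal (n * (1 - c)) * (Measure.hausdorffMeasure n : Measure E) S := by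
  set μ := (Measure.hausdorffMeasure n : Measure E)
  obtain ⟨S', hS'⟩ : ∃ S', S' = AffineMap.homothety p c '' S := ⟨_, rfl⟩
  have hS'S : S' ⊆ S := by
    rw [hS']
    rintro _ ⟨x, hx, rfl⟩
    exact (hmaps x hx).1
  have hXS' : X ⊆ S \ S' := by
    rw [hS']
    refine fun x hx => ⟨hX hx, ?_⟩
    rintro ⟨y, hy, rfl⟩
    exact (hmaps y hy).2 hx
  have hmeas : MeasurableSet S' := by
    have : S' = AffineMap.homothety p c⁻¹ ⁻¹' S := by
      rw [hS']
      refine congrFun (Set.image_eq_preimage_of_inverse (fun x => ?_) (fun x => ?_)) S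
      · simp [AffineMap.homothety_apply, smul_smul, inv_mul_cancel₀ hc.ne']
      · simp [AffineMap.homothety_apply, smul_smul, mul_inv_cancel₀ hc.ne']
    rw [this]
    exact (AffineMap.homothety_continuous p c⁻¹).measurable hS
  have hμS' : μ S' = ENNReal.ofReal (c ^ n) * μ S := by
    rw [hS', hausdorffMeasure_homothety_image (Nat.cast_nonneg n) p hc.ne', ENNReal.smul_def,
      smul_eq_mul]
    congr 1
    rw [NNReal.rpow_natCast, ENNReal.ofReal, Real.toNNReal_pow hc.le]
    congr 2
    ext
    rw [coe_nnnorm, Real.norm_of_nonneg hc.le, Real.coe_toNNReal _ hc.le]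
  -- Bernoulli's inequality at `c - 1`.
  have hb : 1 - c ^ n ≤ n * (1 - c) := by
    have := one_add_mul_le_pow (a := c - 1) (by linarith) n
    rw [add_sub_cancel] at this
    linarith
  calc μ X ≤ μ (S \ S') := measure_mono hXS'
    _ = μ S - μ S' := measure_sdiff hS'S hmeas.nullMeasurableSet
        ((measure_mono hS'S).trans_lt hfin).ne
    _ = ENNReal.ofReal (1 - c ^ n) * μ S := by
        rw [hμS', ENNReal.ofReal_sub _ (pow_nonneg hc.le n), ENNReal.sub_mul
          (fun _ _ => hfin.ne), ENNReal.ofReal_one, one_mul]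
    _ ≤ _ := by gcongr

/-! ### Dimension of the slice -/

namespace VeeringTriangulation

variable {A : Type*} [Fintype A] {σ : VeeringTriangulation A}

/-- The codimension one subspace of the width space on which the sum of the widths vanishes. -/
noncomputable def sliceSpace (σ : VeeringTriangulation A) : Submodule ℝ (EuclideanSpace ℝ A) :=
  (σ.widthSpace ⊓ LinearMap.ker (∑ a, LinearMap.proj a : (A → ℝ) →ₗ[ℝ] ℝ)).map
    (WithLp.linearEquiv 2 ℝ (A → ℝ)).symm.toLinearMap

theorem mem_sliceSpace {v : EuclideanSpace ℝ A} :
    v ∈ sliceSpace σ ↔ v.ofLp ∈ σ.widthSpace ∧ ∑ a, v a = 0 := by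
  rw [sliceSpace, Submodule.mem_map_equiv]
  simp

/-- A core triangulation has a width space of dimension `D`, since the width cone spans it; the sum
of the widths is a non-zero functional there, positive at a positive point. -/
theorem finrank_sliceSpace (hσ : σ.IsBalanced) :
    (Module.finrank ℝ (sliceSpace σ) : ℝ) = (σ.stratumDim : ℝ) - 1 := by
  have := hσ.nonempty
  obtain ⟨x, -, hx, -, -⟩ := hσ.exists_mem_balancedParams
  have hs : 0 < ∑ a, x a := Finset.sum_pos (fun a _ => hx.1.1 a) Finset.univ_nonempty
  have hD := hσ.1.1
  rw [span_widthCone hx.2 hx.1.1] at hD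
  obtain ⟨f, hf⟩ : ∃ f : Module.Dual ℝ σ.widthSpace,
      f = (∑ a, LinearMap.proj a : (A → ℝ) →ₗ[ℝ] ℝ) ∘ₗ σ.widthSpace.subtype := ⟨_, rfl⟩
  have hf0 : f ≠ 0 := fun h => by
    have h1 : f ⟨x, hx.2⟩ = 0 := by rw [h]; rfl
    simp [hf] at h1
    exact hs.ne' h1
  have hk := Module.Dual.finrank_ker_add_one_of_ne_zero hf0
  have hmap : (LinearMap.ker f).map σ.widthSpace.subtype =
      σ.widthSpace ⊓ LinearMap.ker (∑ a, LinearMap.proj a : (A → ℝ) →ₗ[ℝ] ℝ) := by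
    rw [hf, LinearMap.ker_comp, Submodule.map_comap_subtype]
  have he : Module.finrank ℝ (sliceSpace σ) = Module.finrank ℝ (LinearMap.ker f) := by
    rw [sliceSpace, LinearEquiv.finrank_map_eq, ← hmap,
      Submodule.finrank_map_subtype_eq]
  rw [← hD, he, ← hk]
  push_cast
  ring

end VeeringTriangulation

/-! ### Measure of the parameter set and of the growth set -/

namespace FlipSequence

open VeeringTriangulation

variable {A : Type*} [Fintype A] [DecidableEq A] {σ τ : VeeringTriangulation A}

theorem inv_mulVec_mulVec (γ : FlipSequence σ τ) (x : A → ℝ) :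
    γ.matrix⁻¹ *ᵥ (γ.matrix *ᵥ x) = x := by
  rw [Matrix.mulVec_mulVec, Matrix.nonsing_inv_mul _
    ((Matrix.isUnit_iff_isUnit_det _).1 γ.isUnit_matrix), Matrix.one_mulVec]

theorem mulVec_inv_mulVec (γ : FlipSequence σ τ) (x : A → ℝ) :
    γ.matrix *ᵥ (γ.matrix⁻¹ *ᵥ x) = x := by
  rw [Matrix.mulVec_mulVec, Matrix.mul_nonsing_inv _
    ((Matrix.isUnit_iff_isUnit_det _).1 γ.isUnit_matrix), Matrix.one_mulVec]

theorem mulVec_mem_Icc (γ : FlipSequence σ τ) {z : A → ℝ} (hz : ∀ a, 0 < z a)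
    (hs : ∑ a, (γ.matrix *ᵥ z) a = 1) : γ.matrix *ᵥ z ∈ Set.Icc (0 : A → ℝ) 1 := by
  have h0 : ∀ a, 0 ≤ (γ.matrix *ᵥ z) a := fun a => by
    refine Finset.sum_nonneg fun b _ => mul_nonneg (le_trans ?_ (γ.one_le_matrix a b)) (hz b).le
    rw [Matrix.one_apply]
    split_ifs <;> norm_num
  refine ⟨h0, fun a => ?_⟩
  rw [Pi.one_apply, ← hs]
  exact Finset.single_le_sum (fun b _ => h0 b) (Finset.mem_univ a)

/-- Pulling back by the inverse matrix exhibits `H_γ` as an open condition on an affine subspace of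
the width space of `σ`, which yields measurability and positive measure. -/
theorem mem_paramSet_iff (γ : FlipSequence σ τ) {x : A → ℝ} :
    x ∈ γ.paramSet ↔
      x ∈ σ.widthSpace ∧ γ.matrix⁻¹ *ᵥ x ∈ τ.balancedRegion ∧ ∑ a, x a = 1 := by
  rw [paramSet_eq]
  constructor
  · rintro ⟨⟨z, hz, rfl⟩, hs⟩
    exact ⟨(γ.mulVec_mem_widthSpace_iff z).2 hz.2, by rw [inv_mulVec_mulVec]; exact hz.1, hs⟩
  · rintro ⟨hx, hr, hs⟩
    refine ⟨⟨_, ⟨hr, ?_⟩, γ.mulVec_inv_mulVec x⟩, hs⟩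
    exact (γ.mulVec_mem_widthSpace_iff _).1 (by rwa [mulVec_inv_mulVec])

theorem measurableSet_paramSet (γ : FlipSequence σ τ) :
    MeasurableSet (WithLp.toLp 2 '' γ.paramSet : Set (EuclideanSpace ℝ A)) := by
  have hK : MeasurableSet γ.paramSet := by
    have : γ.paramSet = (σ.widthSpace : Set (A → ℝ)) ∩
        ((fun x => γ.matrix⁻¹ *ᵥ x) ⁻¹' τ.balancedRegion ∩ {x | ∑ a, x a = 1}) := by
      ext x
      exact γ.mem_paramSet_iff
    rw [this]
    have hc : Continuous fun x : A → ℝ => γ.matrix⁻¹ *ᵥ x := by fun_prop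
    have hs : IsClosed {x : A → ℝ | ∑ a, x a = 1} := isClosed_eq (by fun_prop) (by fun_prop)
    exact (Submodule.closed_of_finiteDimensional _).measurableSet.inter
      ((τ.isOpen_balancedRegion.preimage hc).measurableSet.inter hs.measurableSet)
  exact (MeasurableEquiv.toLp 2 (A → ℝ)).measurableSet_image.2 hK

/-- Both bounds are needed: finiteness to subtract measures, and both for the final inequality to be
strict. -/
theorem lebesgue_paramSet (γ : FlipSequence σ τ) :
    0 < σ.lebesgue γ.paramSet ∧ σ.lebesgue γ.paramSet < ∞ := by
  have := γ.isBalanced_right.nonempty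
  obtain ⟨u, -, hu, -, -⟩ := γ.isBalanced_right.exists_mem_balancedParams
  have hs := γ.sum_mulVec_pos hu.1.1
  obtain ⟨p, hp⟩ : ∃ p, p = simplexProj (γ.matrix *ᵥ u) := ⟨_, rfl⟩
  have hpK : p ∈ γ.paramSet := by
    rw [paramSet_eq, hp]
    exact ⟨⟨_, smul_mem_balancedCone hu (inv_pos.2 hs), Matrix.mulVec_smul _ _ _⟩,
      sum_simplexProj hs⟩
  have hp' := γ.mem_paramSet_iff.1 hpK
  rw [lebesgue, ← finrank_sliceSpace γ.isBalanced_left]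
  have hc : Continuous fun x : EuclideanSpace ℝ A => γ.matrix⁻¹ *ᵥ x.ofLp := by fun_prop
  refine hausdorffMeasure_pos_and_lt_top (p := WithLp.toLp 2 p)
    (U := (fun x : EuclideanSpace ℝ A => γ.matrix⁻¹ *ᵥ x.ofLp) ⁻¹' τ.balancedRegion) ?_ ?_
    (τ.isOpen_balancedRegion.preimage hc) hp'.2.1 ?_
  · rintro _ ⟨x, hx, rfl⟩
    rw [mem_paramSet_iff] at hx
    rw [mem_sliceSpace]
    exact ⟨σ.widthSpace.sub_mem hx.1 hp'.1, by simp [hx.2.2, hp'.2.2]⟩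
  · have hcomp : IsCompact (WithLp.toLp 2 '' Set.Icc (0 : A → ℝ) 1 : Set (EuclideanSpace ℝ A)) :=
      isCompact_Icc.image (PiLp.continuous_toLp 2 _)
    refine hcomp.isBounded.subset (Set.image_mono fun x hx => ?_)
    rw [paramSet_eq] at hx
    obtain ⟨⟨z, hz, rfl⟩, hs⟩ := hx
    exact γ.mulVec_mem_Icc hz.1.1 hs
  · intro x hx hxV
    rw [mem_sliceSpace] at hxV
    refine ⟨x.ofLp, γ.mem_paramSet_iff.2 ⟨?_, hx, ?_⟩, rfl⟩
    · have := σ.widthSpace.add_mem hxV.1 hp'.1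
      simpa using this
    · have h2 := hxV.2
      simp only [PiLp.sub_apply, Finset.sum_sub_distrib, hp'.2.2] at h2
      linarith

theorem lebesgue_growthSet_le (γ : FlipSequence σ τ) {u : A → ℝ} (hu : u ∈ τ.balancedCone)
    (hu1 : ∑ a, u a = 1) {δ M : ℝ} (hδ : 0 < δ) (hM : δ⁻¹ < M) {r : A} (hr : δ ≤ u r) :
    σ.lebesgue (γ.growthSet M r) ≤
      ENNReal.ofReal (((σ.stratumDim : ℝ) - 1) * (M * δ)⁻¹) * σ.lebesgue γ.paramSet := by
  have := γ.isBalanced_right.nonempty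
  have hM0 : 0 < M := (inv_pos.2 hδ).trans hM
  have hMδ : 1 < M * δ := by rwa [inv_lt_iff_one_lt_mul₀ hδ] at hM
  set V := ⨆ s, γ.colNorm s with hV
  have hV0 : 0 < V := one_pos.trans_le ((γ.one_le_colNorm r).trans (γ.colNorm_le_iSup r))
  have hs := γ.sum_mulVec_pos hu.1.1
  have hsV := γ.sum_mulVec_le hu.1.1
  rw [hu1, mul_one] at hsV
  set w := ∑ a, (γ.matrix *ᵥ u) a with hw
  obtain ⟨v, hv⟩ : ∃ v, v = w⁻¹ • u := ⟨_, rfl⟩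
  have hvC : v ∈ τ.balancedCone := hv ▸ smul_mem_balancedCone hu (inv_pos.2 hs)
  have hv1 : ∑ a, (γ.matrix *ᵥ v) a = 1 := by
    rw [hv, Matrix.mulVec_smul]
    simp only [Pi.smul_apply, smul_eq_mul, ← Finset.mul_sum]
    exact inv_mul_cancel₀ hs.ne'
  -- The ratio is chosen for this: the share `1/(Mδ)` of `v` alone already brings `M V z_r` up to 1.
  have hvr : 1 ≤ M * V * ((M * δ)⁻¹ * v r) := by
    have h1 : w⁻¹ * δ ≤ v r := by
      rw [hv]
      exact mul_le_mul_of_nonneg_left hr (inv_pos.2 hs).le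
    calc 1 ≤ V * w⁻¹ := by rwa [← div_eq_mul_inv, one_le_div hs]
      _ = M * V * ((M * δ)⁻¹ * (w⁻¹ * δ)) := by field_simp
      _ ≤ _ := by gcongr
  have hc : 0 < 1 - (M * δ)⁻¹ := sub_pos.2 (inv_lt_one_of_one_lt₀ hMδ)
  have hsub := γ.growthSet_subset (M := M) r
  have hfin := γ.lebesgue_paramSet.2
  rw [lebesgue, ← finrank_sliceSpace γ.isBalanced_left] at hfin
  simp only [lebesgue]
  rw [← finrank_sliceSpace γ.isBalanced_left]
  have key := hausdorffMeasure_le_of_homothety (p := WithLp.toLp 2 (γ.matrix *ᵥ v))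
    (X := WithLp.toLp 2 '' γ.growthSet M r) hc γ.measurableSet_paramSet hfin ?_ ?_
  · rwa [sub_sub_cancel] at key
  · refine Set.image_mono fun x hx => ?_
    obtain ⟨z, hz, rfl, h1, -⟩ := hsub hx
    rw [paramSet_eq]
    exact ⟨⟨z, hz, rfl⟩, h1⟩
  · rintro _ ⟨x, hx, rfl⟩
    rw [paramSet_eq] at hx
    obtain ⟨⟨z, hz, rfl⟩, hz1⟩ := hx
    set c := 1 - (M * δ)⁻¹ with hcdef
    -- The homothety is this convex combination, seen before applying `A_γ`.
    obtain ⟨z', hz'⟩ : ∃ z', z' = c • z + (M * δ)⁻¹ • v := ⟨_, rfl⟩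
    have hz'C : z' ∈ τ.balancedCone := hz' ▸ add_mem_balancedCone
      (smul_mem_balancedCone hz hc) (smul_mem_balancedCone hvC (by positivity))
    have hhom : AffineMap.homothety (WithLp.toLp 2 (γ.matrix *ᵥ v) : EuclideanSpace ℝ A) c
        (WithLp.toLp 2 (γ.matrix *ᵥ z)) = WithLp.toLp 2 (γ.matrix *ᵥ z') := by
      rw [hz', Matrix.mulVec_add, Matrix.mulVec_smul, Matrix.mulVec_smul]
      ext a
      simp [AffineMap.homothety_apply, hcdef]
      ring
    rw [hhom]
    constructor
    · refine ⟨_, ?_, rfl⟩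
      rw [paramSet_eq]
      refine ⟨⟨z', hz'C, rfl⟩, ?_⟩
      rw [hz', Matrix.mulVec_add, Matrix.mulVec_smul, Matrix.mulVec_smul]
      simp only [Pi.add_apply, Pi.smul_apply, smul_eq_mul, Finset.sum_add_distrib,
        ← Finset.mul_sum, hz1, hv1, hcdef]
      ring
    · rintro ⟨y, hy, hyz⟩
      obtain ⟨t, -, rfl, -, ht⟩ := hsub hy
      have heq : t = z' := by
        have h1 := WithLp.toLp_injective 2 hyz
        rw [← γ.inv_mulVec_mulVec t, h1, inv_mulVec_mulVec]
      have hpos : 0 < M * V * (c * z r) :=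
        mul_pos (mul_pos hM0 hV0) (mul_pos hc (hz.1.1 r))
      rw [heq, hz', Pi.add_apply, Pi.smul_apply, Pi.smul_apply, smul_eq_mul, smul_eq_mul,
        mul_add] at ht
      linarith

end FlipSequence

theorem proposition5p6 (A : Type*) [Fintype A] [DecidableEq A] :
    ∃ c M₀ : ℝ, 0 < c ∧ 1 < M₀ ∧
      ∀ M : ℝ, M₀ < M →
        ∀ (σ τ : VeeringTriangulation A) (γ : FlipSequence σ τ) (r : A),
          σ.lebesgue (γ.growthSet M r) < ENNReal.ofReal (c / M) * σ.lebesgue γ.paramSet := by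
  obtain ⟨δ, hδ, h⟩ := VeeringTriangulation.exists_uniform_lower_bound A
  have hδ' := inv_pos.2 hδ
  -- `M > 1/δ` keeps the homothety ratio positive. As `D ≤ card A`, the factor `card A + 1` strictly
  -- exceeds `D - 1`, whence the strict inequality.
  refine ⟨(Fintype.card A + 1) * δ⁻¹, 1 + δ⁻¹, by positivity, by linarith,
    fun M hM σ τ γ r => ?_⟩
  obtain ⟨u, hu, hu1, hur⟩ := h τ γ.isBalanced_right
  have hM0 : 0 < M := by linarith
  obtain ⟨hpos, hfin⟩ := γ.lebesgue_paramSet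
  refine (γ.lebesgue_growthSet_le hu hu1 hδ (by linarith) (hur r)).trans_lt ?_
  refine ENNReal.mul_lt_mul_left hpos.ne' hfin.ne ?_
  rw [ENNReal.ofReal_lt_ofReal_iff (by positivity)]
  have hD : (σ.stratumDim : ℝ) ≤ Fintype.card A := by
    have h1 := Submodule.finrank_le (Submodule.span ℝ σ.widthCone)
    rw [Module.finrank_fintype_fun_eq_card] at h1
    rw [← γ.isBalanced_left.1.1]
    exact_mod_cast h1
  calc ((σ.stratumDim : ℝ) - 1) * (M * δ)⁻¹ < (Fintype.card A + 1) * (M * δ)⁻¹ :=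
        mul_lt_mul_of_pos_right (by linarith) (by positivity)
    _ = _ := by field_simp
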